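/- A number of players take turns throwing darts at a dartboard. A player whose dart lands closer to the center than all previously thrown darts stays in the game (and goes to the back of the line); otherwise the player is eliminated. The game ends as soon as only one player is left. The distances $X_0,X_1,X_2,\dots$ of the further throws to the center are i.i.d. real random variables, and any two of them coincide with probability zero. Suppose that $p\ge 1$ players are left and that the best throw so far has distance $d$ from the center ($d=\infty$ if no dart has been thrown), and let $x=\Pr(X_i<d)\in[0,1]$. Let $L_p(x)$ be the number of remaining throws, $Q_{n,p}(x)=\Pr(L_p(x)=n)$ and $E_p(x)=\mathbb{E}(L_p(x))$, and put $$Q(x,u,z)=\sum_{n\ge0,\;p\ge1}Q_{n,p}(x)\,u^pz^n,\qquad E(x,u)=\sum_{p\ge1}E_p(x)\,u^p .$$ Then every $E_p(x)$ is finite. For every complex $u$ with $0<|u|<1$ the series $E(x,u)$ converges, the double series $Q(x,u,z)$ converges absolutely for all complex $z$ in a neighborhood of $1$, and $Q(x,u,\cdot)$ is complex differentiable at $z=1$, with $$E(x,u)=\left.\frac{\partial Q(x,u,z)}{\partial z}\right|_{z=1}=\frac{u^2}{(1-u)^2}\left(\frac{1-u}{1-(1-x)u}\right)^{1-1/u},$$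 where the power is the principal one. Moreover, if $0<x\le1$ is fixed, then, as $p\to\infty$, $$E_p(x)=p+\log p+\gamma-1+\log x+o(1),$$ where $\gamma$ is Euler's constant. -/

import Mathlib

open MeasureTheory ProbabilityTheory Filter Topology
open scoped ENNReal

noncomputable section

namespace DartGame

/-- A position of the game: the number of players that are still in the game, and the distance
to the center of the best throw so far (`⊤` if no dart has been thrown yet). -/
structure Position where
  players : ℕ
  best : EReal

open Classical in
/-- One throw, landing at distance `r`. If it is closer to the center than all previous throws,
the player who threw it stays in the game and `r` is the new distance to beat; otherwise this
player is eliminated. -/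
def Position.throw (s : Position) (r : ℝ) : Position :=
  if (r : EReal) < s.best then ⟨s.players, r⟩ else ⟨s.players - 1, s.best⟩

/-- The position reached from `s` after the first `n` of the throws `r 0, r 1, r 2, …`. -/
def positionAfter (r : ℕ → ℝ) (s : Position) : ℕ → Position
  | 0 => s
  | n + 1 => (positionAfter r s n).throw (r n)

/-- The number of throws made until only one player is left, when the game continues from a
position with `p` players and distance to beat `d`, and the further throws land at distances
`r 0, r 1, r 2, …`. It is `⊤` if the game never ends. -/
def remainingThrows (r : ℕ → ℝ) (d : EReal) (p : ℕ) : ℕ∞ :=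
  ⨅ (n : ℕ) (_ : (positionAfter r ⟨p, d⟩ n).players = 1), (n : ℕ∞)

variable {Ω : Type*} [MeasurableSpace Ω]

/-- The probability that the game ends after exactly `n` further throws. -/
def endProb (μ : Measure Ω) (X : ℕ → Ω → ℝ) (d : EReal) (n p : ℕ) : ℝ :=
  μ.real {ω | remainingThrows (fun i => X i ω) d p = n}

/-- The general term, for `n ≥ 0` and `p + 1 ≥ 1` players, of the generating function of the
numbers `endProb μ X d n p`. -/
def endProbTerm (μ : Measure Ω) (X : ℕ → Ω → ℝ) (d : EReal) (u z : ℂ) (i : ℕ × ℕ) : ℂ :=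
  (endProb μ X d i.1 (i.2 + 1) : ℂ) * u ^ (i.2 + 1) * z ^ i.1

/-- The generating function of the numbers `endProb μ X d n p`, over `n ≥ 0` and `p ≥ 1`. -/
def endProbGenFun (μ : Measure Ω) (X : ℕ → Ω → ℝ) (d : EReal) (u z : ℂ) : ℂ :=
  ∑' i : ℕ × ℕ, endProbTerm μ X d u z i

/-- The expected number of remaining throws, as an element of `[0, ∞]`. -/
def expectedThrows (μ : Measure Ω) (X : ℕ → Ω → ℝ) (d : EReal) (p : ℕ) : ℝ≥0∞ :=
  ∫⁻ ω, ((remainingThrows (fun i => X i ω) d p : ℕ∞) : ℝ≥0∞) ∂μ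

end DartGame

end

/-! Let the throws go on forever and let `e` be the number of eliminating throws among the first
`n`. With `p + 1` players the game lasts longer than `n` throws exactly when `e < p`
(`lt_remainingThrows_iff`), so everything reduces to the law of `n - e`, the number of throws that
beat all earlier ones.

That law depends only on `q = 1 - x`: the distribution is atomless, so its cdf makes the throws
uniform. Conditioning on the first throw shows that the mean of `v ^ (n - e)` is the coefficient of
`s ^ n` in `(1 - s) ^ (-v) * (1 - q * s) ^ (v - 1)` (`integral_pow_records`). Taking `v = 1 / u` and
`s = u * z` and summing over players and throws gives the survival series `S(z)` in closed form
(`hasSum_survival`). Since end probabilities are differences of survival probabilities, `Q = u / (1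
- u) + (z - 1) * S(z)`, so the derivative at `1` is `S(1)`, which is also the series of
expectations.

For the asymptotics put `M = log ((1 - q * u) / (1 - u)) / u`. Then `E = u ^ 2 / (1 - u) ^ 2 * exp
((1 - u) * M)`, which equals `u ^ 2` times `1 / (1 - u) ^ 2 + M / (1 - u) + M ^ 2 * g ((1 - u) * M)`
with `g W = (exp W - 1 - W) / W ^ 2`. The first two terms give `p - 1` and partial sums that grow
like `log p + γ + log x`. In the third, `M ^ 2` has coefficients tending to zero and `g ((1 - u) *
M)` has absolutely summable ones, so it contributes `o(1)` (`hasSum_expansion`). No singularity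
analysis is needed. -/

namespace DartGame

/-! ### Counting eliminations -/

open Classical in
/-- The number of eliminating throws among the first `n` of the throws `r 0, r 1, …`, when the
distance to beat is `d`. -/
noncomputable def eliminations : ℕ → (ℕ → ℝ) → EReal → ℕ
  | 0, _, _ => 0
  | n + 1, r, d =>
    if (r 0 : EReal) < d then eliminations n (fun i => r (i + 1)) (r 0)
    else eliminations n (fun i => r (i + 1)) d + 1

theorem positionAfter_succ' (r : ℕ → ℝ) (s : Position) (n : ℕ) :
    positionAfter r s (n + 1) = positionAfter (fun i => r (i + 1)) (s.throw (r 0)) n := by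
  induction n with
  | zero => rfl
  | succ n ih => rw [positionAfter, ih]; rfl

theorem players_positionAfter (n : ℕ) (r : ℕ → ℝ) (p : ℕ) (d : EReal) :
    (positionAfter r ⟨p, d⟩ n).players = p - eliminations n r d := by
  induction n generalizing r p d with
  | zero => rfl
  | succ n ih =>
    rw [positionAfter_succ', Position.throw, eliminations]
    split_ifs with h
    · exact ih ..
    · rw [ih]; dsimp only; omega

theorem eliminations_le (n : ℕ) (r : ℕ → ℝ) (d : EReal) : eliminations n r d ≤ n := by
  induction n generalizing r d with
  | zero => rfl
  | succ n ih =>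
    rw [eliminations]
    split_ifs with h
    · exact (ih ..).trans n.le_succ
    · exact Nat.succ_le_succ (ih ..)

theorem eliminations_step (n : ℕ) (r : ℕ → ℝ) (d : EReal) :
    eliminations n r d ≤ eliminations (n + 1) r d ∧
      eliminations (n + 1) r d ≤ eliminations n r d + 1 := by
  induction n generalizing r d with
  | zero => exact ⟨Nat.zero_le _, eliminations_le 1 r d⟩
  | succ n ih =>
    rw [eliminations, eliminations]
    split_ifs with h
    · exact ih ..
    · have := ih (fun i => r (i + 1)) d
      omega

theorem eliminations_mono (r : ℕ → ℝ) (d : EReal) : Monotone fun n => eliminations n r d :=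
  monotone_nat_of_le_succ fun n => (eliminations_step n r d).1

theorem exists_eliminations_eq {n p : ℕ} {r : ℕ → ℝ} {d : EReal} (h : p ≤ eliminations n r d) :
    ∃ m ≤ n, eliminations m r d = p := by
  induction n with
  | zero => exact ⟨0, le_rfl, le_antisymm (Nat.zero_le _) h⟩
  | succ n ih =>
    by_cases h' : p ≤ eliminations n r d
    · obtain ⟨m, hm, e⟩ := ih h'
      exact ⟨m, hm.trans n.le_succ, e⟩
    · have := eliminations_step n r d
      exact ⟨n + 1, le_rfl, by omega⟩

/-- One player is left exactly when the count equals `p`. The count is monotone with steps of at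
most one, so it cannot pass `p` without attaining it. -/
theorem lt_remainingThrows_iff (r : ℕ → ℝ) (d : EReal) (n p : ℕ) :
    (n : ℕ∞) < remainingThrows r d (p + 1) ↔ eliminations n r d < p := by
  rw [← ENat.add_one_le_iff (ENat.natCast_ne_top n), remainingThrows]
  simp only [le_iInf_iff, players_positionAfter]
  constructor
  · intro h
    by_contra! hp
    obtain ⟨m, hm, e⟩ := exists_eliminations_eq hp
    have := h m (by omega)
    norm_cast at this
    omega
  · intro h m hm
    norm_cast
    by_contra! hmn
    have := eliminations_mono r d (Nat.lt_succ_iff.1 hmn)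
    simp only at this
    omega

/-- Joint measurability in the threshold is needed because a successful first throw becomes the new,
random, threshold. -/
theorem measurable_eliminations (n : ℕ) :
    Measurable fun z : EReal × (ℕ → ℝ) => eliminations n z.2 z.1 := by
  induction n with
  | zero => exact measurable_const
  | succ n ih =>
    have hs : Measurable fun z : EReal × (ℕ → ℝ) => fun i => z.2 (i + 1) := by fun_prop
    have h0 : Measurable fun z : EReal × (ℕ → ℝ) => ((z.2 0 : ℝ) : EReal) :=
      measurable_coe_real_ereal.comp (by fun_prop)
    simp only [eliminations]
    exact Measurable.ite (measurableSet_lt h0 measurable_fst)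
      (ih.comp (h0.prodMk hs)) ((ih.comp (measurable_fst.prodMk hs)).add_const 1)

end DartGame

/-! ### Reduction to uniform throws -/

namespace DartGame

theorem continuous_cdf (ν : Measure ℝ) [IsProbabilityMeasure ν] [NullSingletonClass ν] :
    Continuous (cdf ν) := by
  refine continuous_iff_continuousAt.2 fun t => ?_
  have h : ν {t} = 0 := measure_singleton t
  rw [← measure_cdf ν, StieltjesFunction.measure_singleton, ENNReal.ofReal_eq_zero] at h
  rw [(monotone_cdf ν).continuousAt_iff_leftLim_eq_rightLim, StieltjesFunction.rightLim_eq]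
  exact le_antisymm ((monotone_cdf ν).leftLim_le le_rfl) (by linarith)

/-- The distribution function of an atomless probability measure is uniformly distributed. -/
theorem map_cdf_eq_uniform (ν : Measure ℝ) [IsProbabilityMeasure ν] [NullSingletonClass ν] :
    ν.map (cdf ν) = volume.restrict (Set.Icc (0 : ℝ) 1) := by
  have hm : Measurable (cdf ν) := (continuous_cdf ν).measurable
  have surj : ∀ a, 0 < a → a < 1 → ∃ t, cdf ν t = a := fun a h0 h1 =>
    mem_range_of_exists_le_of_exists_ge (continuous_cdf ν)
      (((tendsto_cdf_atBot ν).eventually_lt_const h0).exists.imp fun _ h => h.le)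
      (((tendsto_cdf_atTop ν).eventually_const_lt h1).exists.imp fun _ h => h.le)
  have : IsFiniteMeasure (ν.map (cdf ν)) := inferInstance
  refine Measure.ext_of_Iic _ _ fun a => ?_
  rw [Measure.map_apply hm measurableSet_Iic, Measure.restrict_apply measurableSet_Iic]
  rcases lt_or_ge a 0 with h0 | h0
  · have e1 : cdf ν ⁻¹' Set.Iic a = ∅ :=
      Set.eq_empty_of_forall_notMem fun t ht => absurd (cdf_nonneg ν t) (not_le.2 (ht.trans_lt h0))
    have e2 : Set.Iic a ∩ Set.Icc (0 : ℝ) 1 = ∅ :=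
      Set.eq_empty_of_forall_notMem fun t ht => absurd ht.2.1 (not_le.2 (ht.1.trans_lt h0))
    simp [e1, e2]
  rcases le_or_gt 1 a with h1 | h1
  · have e1 : cdf ν ⁻¹' Set.Iic a = Set.univ :=
      Set.eq_univ_of_forall fun t => (cdf_le_one ν t).trans h1
    have e2 : Set.Iic a ∩ Set.Icc (0 : ℝ) 1 = Set.Icc 0 1 :=
      Set.inter_eq_right.2 fun t ht => ht.2.trans h1
    simp [e1, e2]
  have e2 : Set.Iic a ∩ Set.Icc (0 : ℝ) 1 = Set.Icc 0 a := by
    ext t; simp only [Set.mem_inter_iff, Set.mem_Iic, Set.mem_Icc]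
    exact ⟨fun h => ⟨h.2.1, h.1⟩, fun h => ⟨h.2, h.1, h.2.trans h1.le⟩⟩
  rw [e2, Real.volume_Icc, sub_zero]
  apply le_antisymm
  -- The cdf may be flat at level `a`, so a preimage of `a` need not bound the sublevel set; a
  -- preimage of any `b > a` does, and then `b` decreases to `a`.
  · have key : ∀ b, a < b → b < 1 → ν (cdf ν ⁻¹' Set.Iic a) ≤ ENNReal.ofReal b := by
      intro b hab hb
      obtain ⟨t, ht⟩ := surj b (h0.trans_lt hab) hb
      rw [← ht, ofReal_cdf]
      refine measure_mono fun s hs => ?_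
      by_contra hst
      have := monotone_cdf ν (not_le.1 hst).le
      exact absurd (hab.trans_le (ht.symm.le.trans this)) (not_lt.2 hs)
    have hlim : Tendsto (fun b : ℝ => ENNReal.ofReal b) (𝓝[>] a) (𝓝 (ENNReal.ofReal a)) :=
      (ENNReal.continuous_ofReal.tendsto a).mono_left nhdsWithin_le_nhds
    refine ge_of_tendsto hlim ?_
    filter_upwards [Ioo_mem_nhdsGT h1] with b hb using key b hb.1 hb.2
  · rcases h0.eq_or_lt with rfl | h0
    · simp
    obtain ⟨t, ht⟩ := surj a h0 h1
    rw [← ht, ofReal_cdf]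
    exact measure_mono fun s hs => monotone_cdf ν hs

theorem measurableSet_coe_lt (d : EReal) : MeasurableSet {t : ℝ | (t : EReal) < d} :=
  measurable_coe_real_ereal measurableSet_Iio

/-- Up to the null set where the cdf equals `x`, the throws that beat `d` are those whose cdf value
is at most `x`. -/
theorem setIntegral_comp_cdf (ν : Measure ℝ) [IsProbabilityMeasure ν] [NullSingletonClass ν] (d : EReal)
    {h : ℝ → ℂ} (hh : Continuous h) :
    ∫ t in {t : ℝ | (t : EReal) < d}, h (cdf ν t) ∂ν =
      ∫ y in (0 : ℝ)..ν.real {t : ℝ | (t : EReal) < d}, h y := by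
  set S := {t : ℝ | (t : EReal) < d} with hS
  set x := ν.real S
  have hm : Measurable (cdf ν) := (continuous_cdf ν).measurable
  have h1 : ∀ t ∈ S, cdf ν t ≤ x := fun t ht => by
    rw [cdf_eq_real]
    exact measureReal_mono fun s hs => lt_of_le_of_lt (EReal.coe_le_coe_iff.2 hs) ht
  have h2 : ∀ t ∉ S, x ≤ cdf ν t := fun t ht => by
    rw [cdf_eq_real]
    exact measureReal_mono fun s hs =>
      (EReal.coe_lt_coe_iff.1 (lt_of_lt_of_le hs (not_lt.1 ht))).le
  have h3 : ν (cdf ν ⁻¹' {x}) = 0 := by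
    rw [← Measure.map_apply hm (measurableSet_singleton x), map_cdf_eq_uniform]
    exact measure_singleton x
  have hae : S =ᵐ[ν] cdf ν ⁻¹' Set.Iic x := by
    have : ∀ᵐ t ∂ν, cdf ν t ≠ x := by
      rw [ae_iff]; simpa [Set.preimage] using h3
    filter_upwards [this] with t ht
    refine propext ⟨fun hs => h1 t hs, fun hs => ?_⟩
    by_contra hn
    exact ht (le_antisymm hs (h2 t hn))
  rw [setIntegral_congr_set hae, ← setIntegral_map measurableSet_Iic
    hh.aestronglyMeasurable hm.aemeasurable, map_cdf_eq_uniform,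
    Measure.restrict_restrict measurableSet_Iic,
    intervalIntegral.integral_of_le measureReal_nonneg, ← integral_Icc_eq_integral_Ioc]
  congr 2
  ext t
  have : x ≤ 1 := measureReal_le_one
  simp only [Set.mem_inter_iff, Set.mem_Iic, Set.mem_Icc]
  exact ⟨fun h => ⟨h.2.1, h.1⟩, fun h => ⟨h.2, h.1, h.2.trans this⟩⟩

end DartGame

/-! ### Binomial series and the record polynomials -/

namespace DartGame

/-- The coefficients of the power series of `(1 - s) ^ a`. -/
noncomputable def binomCoeff (a : ℂ) (n : ℕ) : ℂ := (-1) ^ n * Ring.choose a n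

theorem binomCoeff_zero (a : ℂ) : binomCoeff a 0 = 1 := by simp [binomCoeff]

theorem summable_norm_binomCoeff (a : ℂ) {s : ℂ} (hs : ‖s‖ < 1) :
    Summable fun n => ‖binomCoeff a n * s ^ n‖ := by
  have h := (binomialSeries ℂ a).summable_norm_apply (x := -s)
    (Metric.eball_subset_eball binomialSeries_radius_ge_one (by
      rw [← ENNReal.ofReal_one, Metric.eball_ofReal]; simpa using hs))
  refine h.congr fun n => ?_
  rw [binomialSeries_apply]
  simp [binomCoeff]

theorem hasSum_binomCoeff (a : ℂ) {s : ℂ} (hs : ‖s‖ < 1) :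
    HasSum (fun n => binomCoeff a n * s ^ n) ((1 - s) ^ a) := by
  have h := (Complex.one_add_cpow_hasFPowerSeriesOnBall_zero (a := a)).hasSum (y := -s) (by
      rw [← ENNReal.ofReal_one, Metric.eball_ofReal]; simpa using hs)
  rw [zero_add, ← sub_eq_add_neg] at h
  convert! h using 2 with n
  rw [binomialSeries_apply]
  simp [binomCoeff, neg_pow s n]
  ring

theorem binomCoeff_succ (a : ℂ) (n : ℕ) :
    binomCoeff a (n + 1) = binomCoeff a n * ((n - a) / (n + 1)) := by
  have h0 : ((n : ℂ) + 1) ≠ 0 := by exact_mod_cast n.succ_ne_zero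
  have hf : ((n.factorial : ℕ) : ℂ) ≠ 0 := by exact_mod_cast n.factorial_ne_zero
  simp only [binomCoeff, Ring.choose_eq_smul, descPochhammer_succ_right, Polynomial.smeval_mul,
    Nat.factorial_succ]
  simp [Polynomial.smeval_natCast]
  field_simp
  ring

theorem binomCoeff_neg_one (n : ℕ) : binomCoeff (-1) n = 1 := by
  induction n with
  | zero => exact binomCoeff_zero _
  | succ n ih =>
    have h0 : ((n : ℂ) + 1) ≠ 0 := by exact_mod_cast n.succ_ne_zero
    rw [binomCoeff_succ, ih, sub_neg_eq_add, div_self h0, one_mul]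

theorem sum_antidiagonal_binomCoeff (a b : ℂ) (n : ℕ) :
    ∑ i ∈ Finset.HasAntidiagonal.antidiagonal n, binomCoeff a i.1 * binomCoeff b i.2 = binomCoeff (a + b) n := by
  simp only [binomCoeff]
  rw [Ring.add_choose_eq n (Commute.all a b), Finset.mul_sum]
  refine Finset.sum_congr rfl fun i hi => ?_
  rw [← Finset.HasAntidiagonal.mem_antidiagonal.1 hi, pow_add]
  ring

/-- The expectation of `v ^ R`, where `R` is the number of throws among the first `n` that beat
all previous ones, and `q` is the probability of not beating the best throw so far. -/
noncomputable def recordGenFun (v q : ℂ) (n : ℕ) : ℂ :=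
  ∑ i ∈ Finset.HasAntidiagonal.antidiagonal n, binomCoeff (-v) i.1 * (binomCoeff (v - 1) i.2 * q ^ i.2)

/-- This is the recursion from conditioning on the first throw: a miss has weight `q`, and a hit
contributes `v` times an integral over the new threshold, here already evaluated termwise. -/
theorem recordGenFun_succ (v q : ℂ) (n : ℕ) :
    recordGenFun v q (n + 1) = q * recordGenFun v q n +
      v * ∑ i ∈ Finset.HasAntidiagonal.antidiagonal n, binomCoeff (-v) i.1 *
        (binomCoeff (v - 1) i.2 * ((1 - q ^ (i.2 + 1)) / (i.2 + 1))) := by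
  have h1 := sum_antidiagonal_binomCoeff (-v) (v - 1) n
  have h2 := sum_antidiagonal_binomCoeff (-v) (v - 1) (n + 1)
  rw [show -v + (v - 1) = -1 by ring, binomCoeff_neg_one] at h1 h2
  rw [Finset.Nat.sum_antidiagonal_succ'] at h2
  rw [recordGenFun, recordGenFun, Finset.Nat.sum_antidiagonal_succ']
  simp only [binomCoeff_zero, mul_one, pow_zero] at h2 ⊢
  -- Both convolutions equal `1`, as the exponents add to `-1`; this expresses the boundary term
  -- with `i.2 = 0` as a sum over the antidiagonal of `n`.
  have h3 := eq_sub_of_add_eq (h2.trans h1.symm)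
  rw [h3, Finset.mul_sum, Finset.mul_sum, ← Finset.sum_sub_distrib, ← Finset.sum_add_distrib,
    ← Finset.sum_add_distrib]
  refine Finset.sum_congr rfl fun i _ => ?_
  have h0 : ((i.2 : ℂ) + 1) ≠ 0 := by exact_mod_cast i.2.succ_ne_zero
  rw [binomCoeff_succ]
  field_simp
  ring

theorem hasSum_recordGenFun (v q : ℂ) {s : ℂ} (hs : ‖s‖ < 1) (hq : ‖q‖ ≤ 1) :
    Summable (fun n => ‖recordGenFun v q n * s ^ n‖) ∧
    HasSum (fun n => recordGenFun v q n * s ^ n) ((1 - s) ^ (-v) * (1 - q * s) ^ (v - 1)) := by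
  have hqs : ‖q * s‖ < 1 := by
    rw [norm_mul]; exact (mul_le_of_le_one_left (norm_nonneg s) hq).trans_lt hs
  have e : ∀ n, recordGenFun v q n * s ^ n = ∑ i ∈ Finset.HasAntidiagonal.antidiagonal n,
      (binomCoeff (-v) i.1 * s ^ i.1) * (binomCoeff (v - 1) i.2 * (q * s) ^ i.2) := by
    intro n
    rw [recordGenFun, Finset.sum_mul]
    refine Finset.sum_congr rfl fun i hi => ?_
    rw [← Finset.HasAntidiagonal.mem_antidiagonal.1 hi, pow_add, mul_pow]
    ring
  have hA := summable_norm_binomCoeff (-v) hs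
  have hB := summable_norm_binomCoeff (v - 1) hqs
  simp only [e]
  have hS := summable_norm_sum_mul_antidiagonal_of_summable_norm hA hB
  refine ⟨hS, ?_⟩
  rw [← (hasSum_binomCoeff (-v) hs).tsum_eq, ← (hasSum_binomCoeff (v - 1) hqs).tsum_eq,
    tsum_mul_tsum_eq_tsum_sum_antidiagonal_of_summable_norm hA hB]
  exact hS.of_norm.hasSum

end DartGame

/-! ### The law of the number of records -/

namespace DartGame

theorem integral_one_sub_pow (x : ℝ) (j : ℕ) :
    ∫ y in (0 : ℝ)..x, ((1 - y : ℝ) : ℂ) ^ j = (1 - (1 - (x : ℂ)) ^ (j + 1)) / (j + 1) := by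
  have h := intervalIntegral.integral_comp_sub_left (a := 0) (b := x) (fun y : ℝ => y ^ j) 1
  rw [integral_pow] at h
  simp only [← Complex.ofReal_pow, intervalIntegral.integral_ofReal, h]
  simp

theorem continuous_recordGenFun (v : ℂ) (n : ℕ) : Continuous fun q => recordGenFun v q n := by
  unfold recordGenFun
  fun_prop

theorem integral_recordGenFun (v : ℂ) (x : ℝ) (n : ℕ) :
    ∫ y in (0 : ℝ)..x, recordGenFun v ((1 - y : ℝ) : ℂ) n =
      ∑ i ∈ Finset.HasAntidiagonal.antidiagonal n, binomCoeff (-v) i.1 *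
        (binomCoeff (v - 1) i.2 * ((1 - (1 - (x : ℂ)) ^ (i.2 + 1)) / (i.2 + 1))) := by
  unfold recordGenFun
  rw [intervalIntegral.integral_finsetSum]
  · refine Finset.sum_congr rfl fun i _ => ?_
    rw [intervalIntegral.integral_const_mul, intervalIntegral.integral_const_mul,
      integral_one_sub_pow]
  · intro i _
    apply Continuous.intervalIntegrable
    fun_prop

variable {Ω : Type*} [MeasurableSpace Ω]

theorem indepFun_zero_tail {μ : Measure Ω} {X : ℕ → Ω → ℝ}
    (hmeas : ∀ i, Measurable (X i)) (hindep : iIndepFun X μ) :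
    IndepFun (X 0) (fun ω i => X (i + 1) ω) μ := by
  rw [IndepFun_iff_Indep]
  refine indep_of_indep_of_le_right (indep_of_indep_of_le_left (indep_iSup_of_disjoint
    (fun i => (hmeas i).comap_le) hindep.iIndep (S := {0}) (T := {0}ᶜ) disjoint_compl_right) ?_) ?_
  · exact le_iSup₂_of_le 0 rfl le_rfl
  · rw [MeasurableSpace.pi, MeasurableSpace.comap_iSup]
    refine iSup_le fun i => ?_
    rw [MeasurableSpace.comap_comp]
    exact le_iSup₂_of_le (i + 1) (Nat.succ_ne_zero i) le_rfl

theorem norm_pow_sub_le (v : ℂ) (n m : ℕ) : ‖v ^ (n - m)‖ ≤ max 1 ‖v‖ ^ n := by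
  rw [norm_pow]
  exact (pow_le_pow_left₀ (norm_nonneg v) (le_max_right _ _) _).trans
    (pow_le_pow_right₀ (le_max_left _ _) (Nat.sub_le _ _))

theorem measurable_eliminations_comp {X : ℕ → Ω → ℝ} (hmeas : ∀ i, Measurable (X i)) (d : EReal)
    (n : ℕ) : Measurable fun ω => eliminations n (fun i => X i ω) d :=
  (measurable_eliminations n).comp (measurable_const.prodMk (measurable_pi_lambda _ hmeas))

/-- Induction on `n` for all sequences and thresholds at once: given the first throw, the remaining
ones form an independent sequence of the same kind, with a possibly smaller threshold. -/
theorem integral_pow_records (μ : Measure Ω) [IsProbabilityMeasure μ]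
    (ν : Measure ℝ) [IsProbabilityMeasure ν] [NullSingletonClass ν] (v : ℂ) (n : ℕ)
    (X : ℕ → Ω → ℝ) (hmeas : ∀ i, Measurable (X i)) (hindep : iIndepFun X μ)
    (hlaw : ∀ i, μ.map (X i) = ν) (d : EReal) :
    ∫ ω, v ^ (n - eliminations n (fun i => X i ω) d) ∂μ =
      recordGenFun v (1 - ν.real {t : ℝ | (t : EReal) < d}) n := by
  classical
  induction n generalizing X d with
  | zero => simp [eliminations, recordGenFun, binomCoeff_zero]
  | succ n ih =>
    set Y : ℕ → Ω → ℝ := fun i => X (i + 1) with hY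
    have hYm : ∀ i, Measurable (Y i) := fun i => hmeas _
    have IH := ih Y hYm (hindep.precomp (Nat.succ_injective)) (fun i => hlaw _)
    set S : Set ℝ := {t : ℝ | (t : EReal) < d} with hS
    have hSm : MeasurableSet S := measurableSet_coe_lt d
    let Φ : ℝ × (ℕ → ℝ) → ℂ := fun z =>
      if z.1 ∈ S then v * v ^ (n - eliminations n z.2 z.1) else v ^ (n - eliminations n z.2 d)
    have hΦ : Measurable Φ := by
      have m1 : Measurable fun z : ℝ × (ℕ → ℝ) => eliminations n z.2 z.1 :=
        (measurable_eliminations n).comp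
          ((measurable_coe_real_ereal.comp measurable_fst).prodMk measurable_snd)
      have m2 : Measurable fun z : ℝ × (ℕ → ℝ) => eliminations n z.2 d :=
        (measurable_eliminations n).comp (measurable_const.prodMk measurable_snd)
      exact Measurable.ite (measurable_fst hSm)
        (((measurable_from_top (f := fun k : ℕ => v ^ (n - k))).comp m1).const_mul v)
        ((measurable_from_top (f := fun k : ℕ => v ^ (n - k))).comp m2)
    have hstep : ∀ ω, v ^ (n + 1 - eliminations (n + 1) (fun i => X i ω) d) =
        Φ (X 0 ω, fun i => Y i ω) := by
      intro ω
      -- This bound makes the truncated subtraction exact when the first throw is a record.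
      have hle := eliminations_le n (fun i => X (i + 1) ω) (X 0 ω)
      simp only [eliminations, Φ, hS, Set.mem_ofPred_eq, hY]
      split_ifs with h
      · rw [← pow_succ']
        congr 1
        omega
      · congr 1
        omega
    have hYmeas : Measurable fun ω i => Y i ω := measurable_pi_lambda _ hYm
    have hprod := (indepFun_iff_map_prod_eq_prod_map_map (hmeas 0).aemeasurable
      hYmeas.aemeasurable).1 (indepFun_zero_tail hmeas hindep)
    have : IsProbabilityMeasure (μ.map fun ω i => Y i ω) :=
      Measure.isProbabilityMeasure_map hYmeas.aemeasurable
    rw [hlaw 0] at hprod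
    have hint : Integrable Φ (ν.prod (μ.map fun ω i => Y i ω)) := by
      refine Integrable.of_bound hΦ.aestronglyMeasurable (max 1 ‖v‖ ^ (n + 1))
        (Eventually.of_forall fun z => ?_)
      have h1 : (1 : ℝ) ≤ max 1 ‖v‖ := le_max_left _ _
      simp only [Φ]
      split_ifs
      · rw [norm_mul, pow_succ']
        exact mul_le_mul (le_max_right _ _) (norm_pow_sub_le ..) (norm_nonneg _) (by positivity)
      · exact (norm_pow_sub_le ..).trans (pow_le_pow_right₀ h1 n.le_succ)
    have hinner : ∀ t, ∫ y, Φ (t, y) ∂(μ.map fun ω i => Y i ω) =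
        S.piecewise (fun t => v * recordGenFun v ((1 - cdf ν t : ℝ) : ℂ) n)
          (fun _ => recordGenFun v (1 - ν.real S) n) t := by
      intro t
      rw [integral_map (f := fun y => Φ (t, y)) hYmeas.aemeasurable
        (hΦ.comp measurable_prodMk_left).aestronglyMeasurable]
      by_cases ht : t ∈ S
      -- The new probability of beating the threshold is the cdf at `t`; strict and weak inequality
      -- agree because there are no atoms.
      · have e : {s : ℝ | (s : EReal) < t} = Set.Iio t := by ext; simp
        simp only [Φ, if_pos ht, Set.piecewise_eq_of_mem _ _ _ ht]
        rw [integral_const_mul, IH, cdf_eq_real, e, measureReal_congr Iio_ae_eq_Iic]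
        push_cast
        rfl
      · simp only [Φ, if_neg ht, Set.piecewise_eq_of_notMem _ _ _ ht]
        exact IH d
    have hc := (continuous_recordGenFun v n)
    have hc' : Continuous fun t => v * recordGenFun v ((1 - cdf ν t : ℝ) : ℂ) n := by
      have := continuous_cdf ν
      exact continuous_const.mul (hc.comp (by fun_prop))
    simp only [hstep]
    rw [← integral_map (φ := fun ω => (X 0 ω, fun i => Y i ω))
      ((hmeas 0).prodMk hYmeas).aemeasurable hΦ.aestronglyMeasurable, hprod, integral_prod _ hint]
    simp only [hinner]
    have hint' : Integrable (fun t => v * recordGenFun v ((1 - cdf ν t : ℝ) : ℂ) n) ν := by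
      obtain ⟨C, hC⟩ := isCompact_Icc.exists_bound_of_continuousOn (s := Set.Icc (0 : ℝ) 1)
        (f := fun y : ℝ => v * recordGenFun v ((1 - y : ℝ) : ℂ) n)
        (continuous_const.mul (hc.comp (by fun_prop))).continuousOn
      exact Integrable.of_bound hc'.aestronglyMeasurable C
        (Eventually.of_forall fun t => hC _ ⟨cdf_nonneg ν t, cdf_le_one ν t⟩)
    rw [integral_piecewise hSm hint'.integrableOn (integrable_const _).integrableOn,
      integral_const_mul, setIntegral_comp_cdf ν d (h := fun y => recordGenFun v ((1 - y : ℝ) : ℂ) n)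
        (hc.comp (by fun_prop)),
      integral_recordGenFun, recordGenFun_succ, setIntegral_const, probReal_compl_eq_one_sub hSm,
      add_comm]
    simp only [Complex.real_smul, Complex.ofReal_sub, Complex.ofReal_one, ← hS]

end DartGame

/-! ### Closed form of the survival series -/

namespace DartGame

theorem hasSum_ite_lt_pow {u : ℂ} (hu : ‖u‖ < 1) (m : ℕ) :
    HasSum (fun p : ℕ => if m < p then u ^ (p + 1) else 0) (u ^ 2 / (1 - u) * u ^ m) := by
  have hinj : Function.Injective fun k : ℕ => k + (m + 1) := add_left_injective _
  rw [← hinj.hasSum_iff]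
  · have h := (hasSum_geometric_of_norm_lt_one hu).mul_left (u ^ (m + 2))
    convert! h using 1
    · funext k
      simp only [Function.comp_apply]
      rw [if_pos (by omega), ← pow_add]
      congr 1
      omega
    · rw [pow_add, div_eq_mul_inv]
      ring
  · intro p hp
    refine if_neg fun h => hp ⟨p - (m + 1), ?_⟩
    simp only
    omega

theorem one_sub_re_pos {w : ℂ} (hw : ‖w‖ < 1) : 0 < (1 - w).re := by
  have := (Complex.abs_re_le_norm w).trans_lt hw
  rw [Complex.sub_re, Complex.one_re]
  linarith [(abs_lt.1 this).2]

theorem one_sub_ne_zero {w : ℂ} (hw : ‖w‖ < 1) : 1 - w ≠ 0 := fun h => by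
  simpa [h] using one_sub_re_pos hw

/-- Both numbers lie in the right half-plane, so their arguments differ by less than `π` and no
branch is crossed. -/
theorem log_one_sub_div_one_sub {a b : ℂ} (ha : ‖a‖ < 1) (hb : ‖b‖ < 1) :
    Complex.log ((1 - a) / (1 - b)) = Complex.log (1 - a) - Complex.log (1 - b) := by
  have a1 := abs_lt.1 (Complex.abs_arg_lt_pi_div_two_iff.2 (Or.inl (one_sub_re_pos ha)))
  have b1 := abs_lt.1 (Complex.abs_arg_lt_pi_div_two_iff.2 (Or.inl (one_sub_re_pos hb)))
  have hπ : (1 - b).arg ≠ Real.pi := by linarith [Real.pi_pos]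
  rw [div_eq_mul_inv, (Complex.log_mul_eq_add_log_iff (one_sub_ne_zero ha)
    (inv_ne_zero (one_sub_ne_zero hb))).2, Complex.log_inv _ hπ, ← sub_eq_add_neg]
  rw [Complex.arg_inv, if_neg hπ]
  constructor <;> linarith

/-- The generating function of the expected numbers of remaining throws. -/
noncomputable def expectedGenFun (q u : ℂ) : ℂ :=
  u ^ 2 / (1 - u) ^ 2 * ((1 - u) / (1 - q * u)) ^ (1 - 1 / u)

theorem norm_mul_lt_one {q u : ℂ} (hq : ‖q‖ ≤ 1) (hu : ‖u‖ < 1) : ‖q * u‖ < 1 := by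
  rw [norm_mul]
  exact (mul_le_of_le_one_left (norm_nonneg u) hq).trans_lt hu

theorem expectedGenFun_eq_exp {q u : ℂ} (hq : ‖q‖ ≤ 1) (hu : ‖u‖ < 1) :
    expectedGenFun q u = u ^ 2 / (1 - u) ^ 2 *
      Complex.exp ((Complex.log (1 - u) - Complex.log (1 - q * u)) * (1 - 1 / u)) := by
  have hqu := norm_mul_lt_one hq hu
  rw [expectedGenFun, Complex.cpow_def_of_ne_zero
    (div_ne_zero (one_sub_ne_zero hu) (one_sub_ne_zero hqu)), log_one_sub_div_one_sub hu hqu]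

/-- The generating function of the probabilities that the game has not ended. -/
noncomputable def survivalGenFun (q u z : ℂ) : ℂ :=
  u ^ 2 / (1 - u) * ((1 - u * z) ^ (-u⁻¹) * (1 - q * (u * z)) ^ (u⁻¹ - 1))

theorem survivalGenFun_one {q u : ℂ} (hq : ‖q‖ ≤ 1) (hu : ‖u‖ < 1) :
    survivalGenFun q u 1 = expectedGenFun q u := by
  have ha0 := one_sub_ne_zero hu
  have hb0 := one_sub_ne_zero (norm_mul_lt_one hq hu)
  rw [expectedGenFun_eq_exp hq hu, survivalGenFun, mul_one, Complex.cpow_def_of_ne_zero ha0,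
    Complex.cpow_def_of_ne_zero hb0, ← Complex.exp_add]
  have e1 : u ^ 2 / (1 - u) = u ^ 2 / (1 - u) ^ 2 * Complex.exp (Complex.log (1 - u)) := by
    rw [Complex.exp_log ha0]; field_simp
  rw [e1, mul_assoc, ← Complex.exp_add]
  congr 2
  ring

section Counting

variable {Ω : Type*} [MeasurableSpace Ω] {μ : Measure Ω} [IsProbabilityMeasure μ]
  {e : ℕ → Ω → ℕ}

theorem measurableSet_count_lt (he : ∀ n, Measurable (e n)) (n p : ℕ) :
    MeasurableSet {ω | e n ω < p} :=
  measurableSet_lt (he n) measurable_const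

theorem hasSum_measureReal_lt (he : ∀ n, Measurable (e n)) (n : ℕ) {u : ℂ} (hu : ‖u‖ < 1) :
    HasSum (fun p : ℕ => (μ.real {ω | e n ω < p} : ℂ) * u ^ (p + 1))
      (u ^ 2 / (1 - u) * ∫ ω, u ^ e n ω ∂μ) := by
  have hset := measurableSet_count_lt he n
  have h := hasSum_integral_of_dominated_convergence (μ := μ)
    (F := fun p ω => if e n ω < p then u ^ (p + 1) else 0)
    (f := fun ω => u ^ 2 / (1 - u) * u ^ e n ω) (fun p _ => ‖u‖ ^ (p + 1))
    (fun p => (Measurable.ite (hset p) measurable_const measurable_const).aestronglyMeasurable)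
    (fun p => Eventually.of_forall fun ω => by
      split_ifs
      · rw [norm_pow]
      · rw [norm_zero]; positivity)
    (Eventually.of_forall fun ω =>
      (summable_nat_add_iff 1).2 (summable_geometric_of_lt_one (norm_nonneg u) hu))
    (integrable_const _)
    (Eventually.of_forall fun ω => hasSum_ite_lt_pow hu (e n ω))
  rw [integral_const_mul] at h
  convert! h using 2 with p
  have := integral_indicator_const (μ := μ) (u ^ (p + 1)) (hset p)
  rw [Complex.real_smul] at this
  rw [← this]
  refine integral_congr_ae (Eventually.of_forall fun ω => ?_)
  simp [Set.indicator]

variable {q : ℂ}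

theorem hasSum_survival (he : ∀ n, Measurable (e n)) (hq : ‖q‖ ≤ 1)
    (hgen : ∀ u : ℂ, u ≠ 0 → ∀ n, ∫ ω, u ^ e n ω ∂μ = u ^ n * recordGenFun u⁻¹ q n)
    {u z : ℂ} (hu0 : u ≠ 0) (hu : ‖u‖ < 1) (huz : ‖u * z‖ < 1) :
    HasSum (fun i : ℕ × ℕ => (μ.real {ω | e i.1 ω < i.2} : ℂ) * u ^ (i.2 + 1) * z ^ i.1)
      (survivalGenFun q u z) := by
  have hfib : ∀ (u z : ℂ), u ≠ 0 → ‖u‖ < 1 → ∀ n,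
      HasSum (fun p : ℕ => (μ.real {ω | e n ω < p} : ℂ) * u ^ (p + 1) * z ^ n)
        (u ^ 2 / (1 - u) * (recordGenFun u⁻¹ q n * (u * z) ^ n)) := by
    intro u z hu0 hu n
    have h := (hasSum_measureReal_lt (μ := μ) he n hu).mul_right (z ^ n)
    rw [hgen u hu0] at h
    convert! h using 1
    rw [mul_pow]
    ring
  have hs : Summable fun i : ℕ × ℕ =>
      (μ.real {ω | e i.1 ω < i.2} : ℂ) * u ^ (i.2 + 1) * z ^ i.1 := by
    -- The norms are the terms of the same series at `‖u‖` and `‖z‖`, where the row sums are known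
    -- too. This is why `hgen` is assumed for every nonzero `u`.
    apply Summable.of_norm
    have hr0 : ((‖u‖ : ℝ) : ℂ) ≠ 0 := by simpa using hu0
    have hr1 : ‖((‖u‖ : ℝ) : ℂ)‖ < 1 := by simpa using hu
    have hf := hfib (‖u‖ : ℝ) (‖z‖ : ℝ) hr0 hr1
    rw [summable_prod_of_nonneg fun i => norm_nonneg _]
    have hnorm : ∀ n p : ℕ, ‖(μ.real {ω | e n ω < p} : ℂ) * u ^ (p + 1) * z ^ n‖ =
        ((μ.real {ω | e n ω < p} : ℂ) * ((‖u‖ : ℝ) : ℂ) ^ (p + 1) * ((‖z‖ : ℝ) : ℂ) ^ n).re := by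
      intro n p
      rw [norm_mul, norm_mul, norm_pow, norm_pow, Complex.norm_real,
        Real.norm_of_nonneg measureReal_nonneg]
      norm_cast
    simp only [hnorm]
    refine ⟨fun n => (Complex.hasSum_re (hf n)).summable, ?_⟩
    simp only [fun n => (Complex.hasSum_re (hf n)).tsum_eq]
    have hrz : ‖((‖u‖ : ℝ) : ℂ) * ((‖z‖ : ℝ) : ℂ)‖ < 1 := by simpa using huz
    exact ((hasSum_recordGenFun _ q hrz hq).1.of_norm.mul_left _).map Complex.reCLM
      Complex.reCLM.continuous
  have h1 := hs.hasSum.prod_fiberwise (hfib u z hu0 hu)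
  have h2 := (hasSum_recordGenFun u⁻¹ q huz hq).2.mul_left (u ^ 2 / (1 - u))
  rw [survivalGenFun, h2.unique h1]
  exact hs.hasSum

theorem differentiableAt_survivalGenFun (hq : ‖q‖ ≤ 1) {u : ℂ} (hu : ‖u‖ < 1) :
    DifferentiableAt ℂ (survivalGenFun q u) 1 := by
  have hqu := norm_mul_lt_one hq hu
  have key : ∀ w : ℂ, ‖w‖ < 1 → 1 - w ∈ Complex.slitPlane := fun w hw => by
    rw [sub_eq_add_neg]; exact Complex.mem_slitPlane_of_norm_lt_one (by simpa using hw)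
  unfold survivalGenFun
  refine DifferentiableAt.const_mul (DifferentiableAt.mul ?_ ?_) _
  · exact DifferentiableAt.cpow (by fun_prop) (by fun_prop) (by simpa using key u hu)
  · exact DifferentiableAt.cpow (by fun_prop) (by fun_prop) (by simpa using key _ hqu)

end Counting

end DartGame

/-! ### Expectations and end probabilities from survival -/

namespace DartGame

theorem tsum_ite_lt_toENNReal (L : ℕ∞) :
    ∑' n : ℕ, (if (n : ℕ∞) < L then (1 : ℝ≥0∞) else 0) = (L : ℝ≥0∞) := by
  induction L using ENat.recTopCoe with
  | top => simp
  | coe k =>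
    simp only [Nat.cast_lt]
    rw [tsum_eq_sum (s := Finset.range k) fun n hn => if_neg (by simpa using hn)]
    rw [Finset.sum_congr rfl fun n hn => if_pos (Finset.mem_range.1 hn)]
    simp

variable {Ω : Type*} [MeasurableSpace Ω] {μ : Measure Ω} [IsProbabilityMeasure μ]
  {X : ℕ → Ω → ℝ}

/-- The probability that fewer than `p` of the first `n` throws are eliminating. -/
noncomputable def survivalProb (μ : Measure Ω) (X : ℕ → Ω → ℝ) (d : EReal) (n p : ℕ) : ℝ :=
  μ.real {ω | eliminations n (fun i => X i ω) d < p}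

/-- The tail-sum formula for the mean, valid in `[0, ∞]` and so before finiteness is known. -/
theorem expectedThrows_succ (hmeas : ∀ i, Measurable (X i)) (d : EReal) (p : ℕ) :
    expectedThrows μ X d (p + 1) = ∑' n, ENNReal.ofReal (survivalProb μ X d n p) := by
  have hset := fun n => measurableSet_count_lt (fun n => measurable_eliminations_comp hmeas d n) n p
  unfold expectedThrows survivalProb
  simp only [← tsum_ite_lt_toENNReal, lt_remainingThrows_iff]
  rw [lintegral_tsum fun n =>
    (Measurable.ite (hset n) measurable_const measurable_const).aemeasurable]
  refine tsum_congr fun n => ?_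
  rw [ofReal_measureReal, ← lintegral_indicator_one (hset n)]
  refine lintegral_congr fun ω => ?_
  simp [Set.indicator]

theorem endProb_zero (hmeas : ∀ i, Measurable (X i)) (d : EReal) (p : ℕ) :
    endProb μ X d 0 (p + 1) = 1 - survivalProb μ X d 0 p := by
  have hset := measurableSet_count_lt (fun n => measurable_eliminations_comp hmeas d n) 0 p
  rw [survivalProb, ← probReal_compl_eq_one_sub hset, endProb]
  congr 1
  ext ω
  have := lt_remainingThrows_iff (fun i => X i ω) d 0 p
  simp only [Set.mem_ofPred_eq, Set.mem_compl_iff, ← this]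
  simp

theorem endProb_succ (hmeas : ∀ i, Measurable (X i)) (d : EReal) (n p : ℕ) :
    endProb μ X d (n + 1) (p + 1) = survivalProb μ X d n p - survivalProb μ X d (n + 1) p := by
  have hset := measurableSet_count_lt (fun n => measurable_eliminations_comp hmeas d n) (n + 1) p
  rw [survivalProb, survivalProb, ← measureReal_sdiff _ hset, endProb]
  · congr 1
    ext ω
    have h1 := lt_remainingThrows_iff (fun i => X i ω) d n p
    have h2 := lt_remainingThrows_iff (fun i => X i ω) d (n + 1) p
    simp only [Set.mem_ofPred_eq, Set.mem_sdiff, ← h1, ← h2]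
    rw [← ENat.add_one_le_iff (ENat.natCast_ne_top n), not_lt, and_comm]
    exact le_antisymm_iff
  · intro ω h
    exact (eliminations_mono _ d n.le_succ).trans_lt h

/-- The generating function of the game is determined by the survival probabilities. -/
theorem hasSum_endProbTerm (hmeas : ∀ i, Measurable (X i)) (d : EReal) {u z S : ℂ} (hu : ‖u‖ < 1)
    (hS : HasSum (fun i : ℕ × ℕ => (survivalProb μ X d i.1 i.2 : ℂ) * u ^ (i.2 + 1) * z ^ i.1) S) :
    HasSum (endProbTerm μ X d u z) (u / (1 - u) + (z - 1) * S) := by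
  -- The differences of survival probabilities split into three series: this one for survival before
  -- any throw, the shifted series `z * S`, and `-S`.
  have h0 : HasSum (fun i : ℕ × ℕ => if i.1 = 0 then u ^ (i.2 + 1) else 0) (u / (1 - u)) := by
    have hinj : Function.Injective fun p : ℕ => ((0, p) : ℕ × ℕ) := Prod.mk_right_injective 0
    rw [← hinj.hasSum_iff]
    · have h := (hasSum_geometric_of_norm_lt_one hu).mul_left u
      convert! h using 1
      funext p
      simp [pow_succ']
    · rintro ⟨n, p⟩ h
      exact if_neg fun hn => h ⟨p, by simp_all⟩
  have h1 : HasSum (fun i : ℕ × ℕ => if i.1 = 0 then 0 else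
      (survivalProb μ X d (i.1 - 1) i.2 : ℂ) * u ^ (i.2 + 1) * z ^ i.1) (z * S) := by
    have hinj : Function.Injective fun i : ℕ × ℕ => (i.1 + 1, i.2) := by
      rintro ⟨a, b⟩ ⟨a', b'⟩ h
      simp_all
    rw [← hinj.hasSum_iff]
    · convert! hS.mul_left z using 1
      funext i
      simp [pow_succ]
      ring
    · rintro ⟨n, p⟩ h
      exact if_pos (by_contra fun hn => h ⟨(n - 1, p), by simp; omega⟩)
  have h := (h0.add h1).sub hS
  convert! h using 1
  · funext i
    obtain ⟨n, p⟩ := i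
    cases n with
    | zero => simp [endProbTerm, endProb_zero hmeas]; ring
    | succ n => simp [endProbTerm, endProb_succ hmeas]; ring
  · ring

end DartGame

/-! ### Power series with absolutely summable coefficients -/

namespace DartGame

open Finset.HasAntidiagonal in
-- The `ℓ¹` norm is submultiplicative under the Cauchy product.
theorem summable_norm_coeff_pow {w : ℕ → ℂ} (hw : Summable fun n => ‖w n‖) (k : ℕ) :
    (Summable fun n => ‖PowerSeries.coeff n (PowerSeries.mk w ^ k)‖) ∧
      ∑' n, ‖PowerSeries.coeff n (PowerSeries.mk w ^ k)‖ ≤ (∑' n, ‖w n‖) ^ k := by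
  induction k with
  | zero =>
    have h : HasSum (fun n => ‖PowerSeries.coeff n (PowerSeries.mk w ^ 0)‖) 1 := by
      convert! hasSum_ite_eq 0 (1 : ℝ) using 1
      funext n
      rw [pow_zero, PowerSeries.coeff_one]
      split_ifs <;> simp
    exact ⟨h.summable, h.tsum_eq.le⟩
  | succ k ih =>
    obtain ⟨h1, h2⟩ := ih
    have hc : ∀ n, PowerSeries.coeff n (PowerSeries.mk w ^ (k + 1)) =
        ∑ i ∈ antidiagonal n, PowerSeries.coeff i.1 (PowerSeries.mk w ^ k) * w i.2 := by
      intro n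
      rw [pow_succ, PowerSeries.coeff_mul]
      simp
    have h1' : Summable fun n => ‖‖PowerSeries.coeff n (PowerSeries.mk w ^ k)‖‖ := by simpa using h1
    have hw' : Summable fun n => ‖‖w n‖‖ := by simpa using hw
    have hs := (summable_norm_sum_mul_antidiagonal_of_summable_norm h1' hw').of_norm
    have hle : ∀ n, ‖PowerSeries.coeff n (PowerSeries.mk w ^ (k + 1))‖ ≤
        ∑ i ∈ antidiagonal n, ‖PowerSeries.coeff i.1 (PowerSeries.mk w ^ k)‖ * ‖w i.2‖ := by
      intro n
      rw [hc]
      exact (norm_sum_le _ _).trans_eq (Finset.sum_congr rfl fun _ _ => norm_mul _ _)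
    have hs' := Summable.of_nonneg_of_le (fun n => norm_nonneg _) hle hs
    refine ⟨hs', (hs'.tsum_le_tsum hle hs).trans ?_⟩
    rw [← tsum_mul_tsum_eq_tsum_sum_antidiagonal_of_summable_norm h1' hw', pow_succ]
    exact mul_le_mul_of_nonneg_right h2 (tsum_nonneg fun _ => norm_nonneg _)

theorem norm_mul_pow_le_of_norm_le_one {u : ℂ} (hu : ‖u‖ ≤ 1) (a : ℂ) (n : ℕ) :
    ‖a * u ^ n‖ ≤ ‖a‖ := by
  rw [norm_mul, norm_pow]
  exact mul_le_of_le_one_right (norm_nonneg a) (pow_le_one₀ (norm_nonneg u) hu)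

theorem summable_norm_mul_pow {a : ℕ → ℂ} (ha : Summable fun n => ‖a n‖) {u : ℂ} (hu : ‖u‖ ≤ 1) :
    Summable fun n => ‖a n * u ^ n‖ :=
  Summable.of_nonneg_of_le (fun _ => norm_nonneg _)
    (fun n => norm_mul_pow_le_of_norm_le_one hu (a n) n) ha

open Finset.HasAntidiagonal in
/-- The Cauchy product of two absolutely convergent power series. -/
theorem hasSum_antidiagonal_mul_pow {a b : ℕ → ℂ} {u A B : ℂ}
    (ha : Summable fun n => ‖a n * u ^ n‖) (hb : Summable fun n => ‖b n * u ^ n‖)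
    (hA : HasSum (fun n => a n * u ^ n) A) (hB : HasSum (fun n => b n * u ^ n) B) :
    HasSum (fun n => (∑ i ∈ antidiagonal n, a i.1 * b i.2) * u ^ n) (A * B) ∧
      Summable fun n => ‖(∑ i ∈ antidiagonal n, a i.1 * b i.2) * u ^ n‖ := by
  have e : ∀ n, (∑ i ∈ antidiagonal n, a i.1 * b i.2) * u ^ n =
      ∑ i ∈ antidiagonal n, a i.1 * u ^ i.1 * (b i.2 * u ^ i.2) := by
    intro n
    rw [Finset.sum_mul]
    refine Finset.sum_congr rfl fun i hi => ?_
    rw [← mem_antidiagonal.1 hi, pow_add]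
    ring
  simp only [e]
  have hS := summable_norm_sum_mul_antidiagonal_of_summable_norm ha hb
  refine ⟨?_, hS⟩
  rw [← hA.tsum_eq, ← hB.tsum_eq,
    tsum_mul_tsum_eq_tsum_sum_antidiagonal_of_summable_norm ha hb]
  exact hS.of_norm.hasSum

theorem hasSum_coeff_pow {w : ℕ → ℂ} (hw : Summable fun n => ‖w n‖) {u W : ℂ} (hu : ‖u‖ ≤ 1)
    (hW : HasSum (fun n => w n * u ^ n) W) (k : ℕ) :
    HasSum (fun n => PowerSeries.coeff n (PowerSeries.mk w ^ k) * u ^ n) (W ^ k) := by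
  induction k with
  | zero =>
    convert! hasSum_ite_eq 0 (1 : ℂ) using 1
    funext n
    rw [pow_zero, PowerSeries.coeff_one]
    split_ifs with h <;> simp [h]
  | succ k ih =>
    have h := (hasSum_antidiagonal_mul_pow
      (summable_norm_mul_pow (summable_norm_coeff_pow hw k).1 hu)
      (summable_norm_mul_pow hw hu) ih hW).1
    convert! h using 1
    funext n
    rw [pow_succ, PowerSeries.coeff_mul]
    simp only [PowerSeries.coeff_mk]

/-- Composing an entire function with an absolutely summable power series gives an absolutely
summable power series. -/
theorem exists_summable_comp {w φ : ℕ → ℂ} (hw : Summable fun n => ‖w n‖)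
    (hφ : ∀ r : ℝ, 0 ≤ r → Summable fun k => ‖φ k‖ * r ^ k) :
    ∃ b : ℕ → ℂ, (Summable fun n => ‖b n‖) ∧ ∀ u W : ℂ, ‖u‖ ≤ 1 →
      HasSum (fun n => w n * u ^ n) W → HasSum (fun n => b n * u ^ n) (∑' k, φ k * W ^ k) := by
  -- This double family is absolutely summable; summing over the power first gives coefficients that
  -- do not depend on `u`.
  set f : ℕ × ℕ → ℂ := fun i => φ i.1 * PowerSeries.coeff i.2 (PowerSeries.mk w ^ i.1) with hf
  have hs : Summable fun i => ‖f i‖ := by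
    rw [summable_prod_of_nonneg fun _ => norm_nonneg _]
    simp only [hf, norm_mul]
    refine ⟨fun k => (summable_norm_coeff_pow hw k).1.mul_left _, ?_⟩
    simp only [tsum_mul_left]
    exact Summable.of_nonneg_of_le
      (fun k => mul_nonneg (norm_nonneg _) (tsum_nonneg fun _ => norm_nonneg _))
      (fun k => mul_le_mul_of_nonneg_left (summable_norm_coeff_pow hw k).2 (norm_nonneg _))
      (hφ _ (tsum_nonneg fun _ => norm_nonneg _))
  have hs' : Summable fun i : ℕ × ℕ => ‖f i.swap‖ := (Equiv.prodComm ℕ ℕ).summable_iff.2 hs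
  have hs2 := (summable_prod_of_nonneg fun _ => norm_nonneg _).1 hs'
  refine ⟨fun n => ∑' k, f (k, n), ?_, fun u W hu hW => ?_⟩
  · exact Summable.of_nonneg_of_le (fun _ => norm_nonneg _)
      (fun n => norm_tsum_le_tsum_norm (hs2.1 n)) hs2.2
  · have hg : Summable fun i : ℕ × ℕ => f i * u ^ i.2 :=
      Summable.of_norm (Summable.of_nonneg_of_le (fun _ => norm_nonneg _)
        (fun i => norm_mul_pow_le_of_norm_le_one hu (f i) i.2) hs)
    have h1 : HasSum (fun k => φ k * W ^ k) (∑' i : ℕ × ℕ, f i * u ^ i.2) := by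
      refine hg.hasSum.prod_fiberwise fun k => ?_
      simp only [hf, mul_assoc]
      exact (hasSum_coeff_pow hw hu hW k).mul_left _
    rw [h1.tsum_eq]
    have h2 := ((Equiv.prodComm ℕ ℕ).hasSum_iff (f := fun i : ℕ × ℕ => f i * u ^ i.2)).2 hg.hasSum
    refine h2.prod_fiberwise fun n => ?_
    have h3 : Summable fun k => f (k, n) := Summable.of_norm (hs2.1 n)
    exact h3.hasSum.mul_right (u ^ n)

open Finset.HasAntidiagonal in
-- Dominated convergence: `a` is bounded, and for fixed `j` the factor `a (n - j)` tends to zero.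
theorem tendsto_sum_antidiagonal_mul_zero {a b : ℕ → ℂ} (ha : Tendsto a atTop (𝓝 0))
    (hb : Summable fun n => ‖b n‖) :
    Tendsto (fun n => ∑ i ∈ antidiagonal n, a i.1 * b i.2) atTop (𝓝 0) := by
  obtain ⟨C, hC⟩ := (Metric.isBounded_range_of_tendsto a ha).exists_norm_le
  have hC' : ∀ n, ‖a n‖ ≤ C := fun n => hC _ ⟨n, rfl⟩
  have h := tendsto_tsum_of_dominated_convergence (𝓕 := atTop)
    (f := fun n j => if j ≤ n then a (n - j) * b j else 0) (g := fun _ => (0 : ℂ))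
    (bound := fun j => C * ‖b j‖) (hb.mul_left C) (fun j => by
      have h1 : Tendsto (fun n => a (n - j) * b j) atTop (𝓝 0) := by
        simpa using (ha.comp (tendsto_sub_atTop_nat j)).mul_const (b j)
      refine h1.congr' ?_
      filter_upwards [eventually_ge_atTop j] with n hn
      rw [if_pos hn])
    (Eventually.of_forall fun n j => by
      split_ifs
      · rw [norm_mul]
        exact mul_le_mul_of_nonneg_right (hC' _) (norm_nonneg _)
      · rw [norm_zero]
        exact mul_nonneg ((norm_nonneg _).trans (hC' 0)) (norm_nonneg _))
  rw [tsum_zero] at h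
  refine h.congr fun n => ?_
  rw [Finset.Nat.sum_antidiagonal_eq_sum_range_succ_mk, ← Finset.sum_range_reflect,
    tsum_eq_sum (s := Finset.range (n + 1))]
  · refine Finset.sum_congr rfl fun j hj => ?_
    have := Finset.mem_range.1 hj
    rw [if_pos (by omega)]
    congr 2
    omega
  · intro j hj
    rw [if_neg]
    simpa using hj

theorem eq_of_hasSum_mul_pow_succ {a b : ℕ → ℂ} {f : ℂ → ℂ}
    (ha : ∀ u : ℂ, u ≠ 0 → ‖u‖ < 1 → HasSum (fun n => a n * u ^ (n + 1)) (f u))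
    (hb : ∀ u : ℂ, u ≠ 0 → ‖u‖ < 1 → HasSum (fun n => b n * u ^ (n + 1)) (f u)) : a = b := by
  set c : ℕ → ℂ := fun n => Nat.casesOn n 0 fun n => a n - b n with hc
  have h : HasFPowerSeriesAt (0 : ℂ → ℂ) (FormalMultilinearSeries.ofScalars ℂ c) 0 := by
    rw [hasFPowerSeriesAt_iff]
    filter_upwards [Metric.ball_mem_nhds (0 : ℂ) one_pos] with u hu
    simp only [FormalMultilinearSeries.coeff_ofScalars, smul_eq_mul, Pi.zero_apply]
    rw [← hasSum_nat_add_iff' 1]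
    rcases eq_or_ne u 0 with rfl | hu0
    · simp [hc]
    · have hu1 : ‖u‖ < 1 := by simpa using hu
      convert! (ha u hu0 hu1).sub (hb u hu0 hu1) using 1
      · funext n
        simp only [hc]
        ring
      · simp [hc]
  funext n
  have := FormalMultilinearSeries.coeff_ofScalars (𝕜 := ℂ) (p := c) (n := n + 1)
  rw [h.eq_zero] at this
  refine sub_eq_zero.1 (this.symm.trans ?_)
  simp [FormalMultilinearSeries.coeff]

end DartGame

/-! ### Coefficients of the logarithm -/

namespace DartGame

/-- The coefficients of the power series of `log ((1 - q * u) / (1 - u)) / u`. -/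
noncomputable def logCoeff (q : ℝ) (n : ℕ) : ℝ := (1 - q ^ (n + 1)) / (n + 1)

section LogCoeff

variable {q : ℝ}

theorem logCoeff_nonneg (h0 : 0 ≤ q) (h1 : q ≤ 1) (n : ℕ) : 0 ≤ logCoeff q n :=
  div_nonneg (sub_nonneg.2 (pow_le_one₀ h0 h1)) (by positivity)

theorem logCoeff_le (h0 : 0 ≤ q) (n : ℕ) : logCoeff q n ≤ 1 / (n + 1) :=
  div_le_div_of_nonneg_right (sub_le_self _ (by positivity)) (by positivity)

theorem mul_pow_mul_one_sub_le (h0 : 0 ≤ q) (h1 : q ≤ 1) (n : ℕ) :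
    (n + 1) * q ^ (n + 1) * (1 - q) ≤ 1 - q ^ (n + 1) := by
  induction n with
  | zero => simp; nlinarith
  | succ n ih =>
    have ht : q ^ (n + 1) ≤ 1 := pow_le_one₀ h0 h1
    have ht0 : 0 ≤ q ^ (n + 1) := by positivity
    have h2 := mul_le_mul_of_nonneg_left ih h0
    have h3 : 0 ≤ (1 - q) * (1 - q * q ^ (n + 1)) :=
      mul_nonneg (by linarith) (by nlinarith)
    rw [pow_succ' q (n + 1)]
    push_cast
    nlinarith

/-- `logCoeff q n` is `1 - q` times the mean of `1, q, …, q ^ n`, and the means of a decreasing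
sequence decrease. Monotonicity makes the norms of `diffCoeff` telescope. -/
theorem logCoeff_antitone (h0 : 0 ≤ q) (h1 : q ≤ 1) : Antitone (logCoeff q) := by
  refine antitone_nat_of_succ_le fun n => ?_
  have h := mul_pow_mul_one_sub_le h0 h1 n
  unfold logCoeff
  rw [div_le_div_iff₀ (by positivity) (by positivity), pow_succ q (n + 1)]
  push_cast
  nlinarith

theorem norm_ofReal_le_one (h0 : 0 ≤ q) (h1 : q ≤ 1) : ‖(q : ℂ)‖ ≤ 1 := by
  rwa [Complex.norm_real, Real.norm_of_nonneg h0]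

theorem hasSum_logCoeff (h0 : 0 ≤ q) (h1 : q ≤ 1) {u : ℂ} (hu0 : u ≠ 0) (hu : ‖u‖ < 1) :
    HasSum (fun n => (logCoeff q n : ℂ) * u ^ n)
      ((Complex.log (1 - q * u) - Complex.log (1 - u)) / u) := by
  have h := (Complex.hasSum_taylorSeries_neg_log hu).sub (Complex.hasSum_taylorSeries_neg_log
    (norm_mul_lt_one (norm_ofReal_le_one h0 h1) hu))
  rw [← hasSum_nat_add_iff' 1] at h
  convert! h.div_const u using 1
  · funext n
    simp only [logCoeff]
    push_cast
    field_simp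
    ring
  · simp
    ring

theorem summable_norm_logCoeff_mul_pow (h0 : 0 ≤ q) (h1 : q ≤ 1) {u : ℂ} (hu : ‖u‖ < 1) :
    Summable fun n => ‖(logCoeff q n : ℂ) * u ^ n‖ := by
  refine Summable.of_nonneg_of_le (fun _ => norm_nonneg _) (fun n => ?_)
    (summable_geometric_of_lt_one (norm_nonneg u) hu)
  rw [norm_mul, norm_pow, Complex.norm_real, Real.norm_of_nonneg (logCoeff_nonneg h0 h1 n)]
  refine mul_le_of_le_one_left (by positivity) ((logCoeff_le h0 n).trans ?_)
  rw [div_le_one (by positivity)]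
  linarith [(Nat.cast_nonneg n : (0 : ℝ) ≤ n)]

/-- The coefficients of the power series of `(1 - u) * log ((1 - q * u) / (1 - u)) / u`. -/
noncomputable def diffCoeff (q : ℝ) (n : ℕ) : ℝ :=
  Nat.casesOn n (logCoeff q 0) fun n => logCoeff q (n + 1) - logCoeff q n

theorem summable_norm_diffCoeff (h0 : 0 ≤ q) (h1 : q ≤ 1) :
    Summable fun n => ‖(diffCoeff q n : ℂ)‖ := by
  rw [← summable_nat_add_iff 1]
  refine summable_of_sum_range_le (c := logCoeff q 0) (fun _ => norm_nonneg _) fun n => ?_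
  have e : ∀ i, ‖(diffCoeff q (i + 1) : ℂ)‖ = logCoeff q i - logCoeff q (i + 1) := by
    intro i
    have h := sub_nonneg.2 (logCoeff_antitone h0 h1 i.le_succ)
    exact (Complex.norm_real _).trans ((norm_sub_rev _ _).trans (Real.norm_of_nonneg h))
  simp only [e]
  rw [Finset.sum_range_sub']
  exact sub_le_self _ (logCoeff_nonneg h0 h1 n)

theorem hasSum_diffCoeff {u M : ℂ} (hM : HasSum (fun n => (logCoeff q n : ℂ) * u ^ n) M) :
    HasSum (fun n => (diffCoeff q n : ℂ) * u ^ n) ((1 - u) * M) := by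
  rw [← hasSum_nat_add_iff' 1]
  have h1 := (hasSum_nat_add_iff' 1).2 hM
  convert! h1.sub (hM.mul_left u) using 1
  · funext n
    simp only [diffCoeff]
    push_cast
    ring
  · simp [diffCoeff]
    ring

open Finset.HasAntidiagonal in
-- By partial fractions the sum is at most twice the Cesàro mean of `1 / (i + 1)`, which tends to
-- zero.
theorem tendsto_sum_antidiagonal_logCoeff (h0 : 0 ≤ q) (h1 : q ≤ 1) :
    Tendsto (fun n => ∑ i ∈ antidiagonal n, logCoeff q i.1 * logCoeff q i.2) atTop (𝓝 0) := by
  have hc := (tendsto_one_div_add_atTop_nhds_zero_nat (𝕜 := ℝ)).cesaro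
  have hb : Tendsto (fun n : ℕ => 2 * (((n + 1 : ℕ) : ℝ)⁻¹ *
      ∑ i ∈ Finset.range (n + 1), 1 / ((i : ℝ) + 1))) atTop (𝓝 0) := by
    simpa using (hc.comp (tendsto_add_atTop_nat 1)).const_mul 2
  refine squeeze_zero (fun n => Finset.sum_nonneg fun i _ =>
    mul_nonneg (logCoeff_nonneg h0 h1 _) (logCoeff_nonneg h0 h1 _)) (fun n => ?_) hb
  have e : ∑ i ∈ antidiagonal n, (1 / ((i.1 : ℝ) + 1) + 1 / ((i.2 : ℝ) + 1)) =
      2 * ∑ i ∈ Finset.range (n + 1), 1 / ((i : ℝ) + 1) := by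
    rw [Finset.sum_add_distrib,
      Finset.Nat.sum_antidiagonal_eq_sum_range_succ_mk (fun i => 1 / ((i.1 : ℝ) + 1)),
      Finset.Nat.sum_antidiagonal_eq_sum_range_succ_mk (fun i => 1 / ((i.2 : ℝ) + 1)),
      two_mul, ← Finset.sum_range_reflect (fun i : ℕ => 1 / ((i : ℝ) + 1))]
    simp
  rw [mul_left_comm, ← e, Finset.mul_sum]
  refine Finset.sum_le_sum fun i hi => ?_
  have hi' : (i.1 : ℝ) + i.2 = n := by exact_mod_cast mem_antidiagonal.1 hi
  have a1 : (0 : ℝ) < i.1 + 1 := by positivity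
  have a2 : (0 : ℝ) < i.2 + 1 := by positivity
  calc logCoeff q i.1 * logCoeff q i.2 ≤ 1 / ((i.1 : ℝ) + 1) * (1 / ((i.2 : ℝ) + 1)) :=
        mul_le_mul (logCoeff_le h0 _) (logCoeff_le h0 _) (logCoeff_nonneg h0 h1 _) (by positivity)
    _ ≤ ((n + 1 : ℕ) : ℝ)⁻¹ * (1 / ((i.1 : ℝ) + 1) + 1 / ((i.2 : ℝ) + 1)) := by
        have e2 : 1 / ((i.1 : ℝ) + 1) + 1 / ((i.2 : ℝ) + 1) =
            (n + 2) * (1 / ((i.1 : ℝ) + 1) * (1 / ((i.2 : ℝ) + 1))) := by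
          rw [← hi']
          field_simp
          ring
        rw [e2, ← mul_assoc, inv_mul_eq_div]
        refine le_mul_of_one_le_left (by positivity) ?_
        rw [one_le_div (by positivity)]
        push_cast
        linarith

theorem tendsto_sum_logCoeff_sub_log (h0 : 0 ≤ q) (h1 : q < 1) :
    Tendsto (fun n : ℕ => ∑ i ∈ Finset.range n, logCoeff q i - Real.log n) atTop
      (𝓝 (Real.eulerMascheroniConstant + Real.log (1 - q))) := by
  have h := (Real.hasSum_pow_div_log_of_abs_lt_one (x := q)
    (by rwa [abs_of_nonneg h0])).tendsto_sum_nat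
  convert! Real.tendsto_harmonic_sub_log.sub h using 1
  · funext n
    have : (harmonic n : ℝ) = ∑ i ∈ Finset.range n, 1 / ((i : ℝ) + 1) := by
      simp [harmonic]
    rw [this, sub_right_comm, ← Finset.sum_sub_distrib]
    simp only [logCoeff, sub_div]
  · simp

end LogCoeff

end DartGame

/-! ### Expansion of the expectations -/

namespace DartGame

theorem tsum_pow_div_factorial_mul_sq (W : ℂ) :
    (∑' k : ℕ, ((k + 2).factorial : ℂ)⁻¹ * W ^ k) * W ^ 2 = Complex.exp W - 1 - W := by
  have h := NormedSpace.expSeries_div_hasSum_exp (𝔸 := ℂ) W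
  rw [← hasSum_nat_add_iff' 2, ← Complex.exp_eq_exp_ℂ] at h
  rw [← tsum_mul_right]
  convert! h.tsum_eq using 1
  · refine tsum_congr fun k => ?_
    rw [pow_add, div_eq_mul_inv]
    ring
  · simp [Finset.sum_range_succ]
    ring

theorem summable_inv_factorial_mul_pow {r : ℝ} (hr : 0 ≤ r) :
    Summable fun k : ℕ => ‖((k + 2).factorial : ℂ)⁻¹‖ * r ^ k := by
  refine Summable.of_nonneg_of_le (fun k => by positivity) (fun k => ?_)
    (Real.summable_pow_div_factorial r)
  rw [norm_inv, Complex.norm_natCast, div_eq_inv_mul]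
  gcongr
  omega

theorem hasSum_expansion {q : ℝ} (h0 : 0 ≤ q) (h1 : q ≤ 1) :
    ∃ D : ℕ → ℂ, Tendsto D atTop (𝓝 0) ∧ ∀ u : ℂ, u ≠ 0 → ‖u‖ < 1 →
      HasSum (fun n : ℕ => ((n + 1 : ℂ) + (∑ i ∈ Finset.range (n + 1), logCoeff q i : ℝ) + D n) *
        u ^ (n + 2)) (expectedGenFun q u) := by
  obtain ⟨b, hb, hb'⟩ := exists_summable_comp (φ := fun k => ((k + 2).factorial : ℂ)⁻¹)
    (summable_norm_diffCoeff h0 h1) (fun r hr => summable_inv_factorial_mul_pow hr)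
  set s : ℕ → ℂ := fun n => ∑ i ∈ Finset.HasAntidiagonal.antidiagonal n,
    (logCoeff q i.1 : ℂ) * (logCoeff q i.2 : ℂ) with hs
  have hs0 : Tendsto s atTop (𝓝 0) := by
    have := (Complex.continuous_ofReal.tendsto 0).comp (tendsto_sum_antidiagonal_logCoeff h0 h1)
    rw [Complex.ofReal_zero] at this
    refine this.congr fun n => ?_
    simp [hs]
  refine ⟨_, tendsto_sum_antidiagonal_mul_zero hs0 hb, fun u hu0 hu => ?_⟩
  have hM := hasSum_logCoeff h0 h1 hu0 hu
  set M := (Complex.log (1 - q * u) - Complex.log (1 - u)) / u with hMdef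
  have hMs := summable_norm_logCoeff_mul_pow h0 h1 hu
  obtain ⟨hS, hSs⟩ := hasSum_antidiagonal_mul_pow hMs hMs hM hM
  have hB := hb' u _ hu.le (hasSum_diffCoeff hM)
  obtain ⟨hD, -⟩ := hasSum_antidiagonal_mul_pow hSs (summable_norm_mul_pow hb hu.le) hS hB
  have ha0 := one_sub_ne_zero hu
  have hone : Summable fun n : ℕ => ‖(1 : ℂ) * u ^ n‖ := by
    simpa using summable_geometric_of_lt_one (norm_nonneg u) hu
  have hone' : HasSum (fun n : ℕ => (1 : ℂ) * u ^ n) (1 - u)⁻¹ := by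
    simpa using hasSum_geometric_of_norm_lt_one hu
  obtain ⟨hA, -⟩ := hasSum_antidiagonal_mul_pow hone hone hone' hone'
  obtain ⟨hC, -⟩ := hasSum_antidiagonal_mul_pow hMs hone hM hone'
  have hsum := ((hA.add hC).add hD).mul_right (u ^ 2)
  convert! hsum using 1
  · funext n
    rw [pow_add]
    simp only [mul_one, Finset.sum_const, Finset.Nat.card_antidiagonal, nsmul_eq_mul]
    rw [Finset.Nat.sum_antidiagonal_eq_sum_range_succ_mk (fun i => (logCoeff q i.1 : ℂ))]
    push_cast
    ring
  · have key := tsum_pow_div_factorial_mul_sq ((1 - u) * M)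
    have hw : (Complex.log (1 - u) - Complex.log (1 - q * u)) * (1 - 1 / u) = (1 - u) * M := by
      rw [hMdef]
      field_simp
      ring
    rw [expectedGenFun_eq_exp (norm_ofReal_le_one h0 h1) hu, hw, eq_add_of_sub_eq
      (eq_add_of_sub_eq key.symm)]
    field_simp
    ring

theorem tendsto_expected {x : ℝ} (hx0 : 0 < x) (hx1 : x ≤ 1) {E : ℕ → ℝ}
    (hE : ∀ u : ℂ, u ≠ 0 → ‖u‖ < 1 →
      HasSum (fun p => (E p : ℂ) * u ^ (p + 1)) (expectedGenFun (1 - (x : ℂ)) u)) :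
    Tendsto (fun p : ℕ => E p -
      ((p + 1 : ℕ) + Real.log (p + 1 : ℕ) + Real.eulerMascheroniConstant - 1 + Real.log x))
      atTop (𝓝 0) := by
  have h0 : 0 ≤ 1 - x := by linarith
  have h1 : 1 - x < 1 := by linarith
  obtain ⟨D, hD0, hD⟩ := hasSum_expansion h0 h1.le
  -- The expansion starts at `u ^ 2`, so the coefficient for a single player is `0`.
  set a : ℕ → ℂ := fun n => Nat.casesOn n 0 fun n =>
    (n + 1 : ℂ) + (∑ i ∈ Finset.range (n + 1), logCoeff (1 - x) i : ℝ) + D n with ha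
  have hEa : (fun p => (E p : ℂ)) = a := by
    refine eq_of_hasSum_mul_pow_succ hE fun u hu0 hu => ?_
    rw [← hasSum_nat_add_iff' 1]
    have := hD u hu0 hu
    push_cast at this
    simpa [ha] using this
  have hEp : ∀ p, E (p + 1) =
      (p + 1) + ∑ i ∈ Finset.range (p + 1), logCoeff (1 - x) i + (D p).re := by
    intro p
    have := congrArg Complex.re (congrFun hEa (p + 1))
    simpa [ha, -Complex.ofReal_sum] using this
  have hDre : Tendsto (fun p => (D p).re) atTop (𝓝 0) :=
    (Complex.continuous_re.tendsto 0).comp hD0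
  have hlog := (tendsto_sum_logCoeff_sub_log h0 h1).comp (tendsto_add_atTop_nat 1)
  rw [sub_sub_cancel] at hlog
  -- With `p + 2` players the partial sum has only `p + 1` terms; this absorbs the shift inside the
  -- logarithm.
  have hll : Tendsto (fun p : ℕ => Real.log (((p + 1 : ℕ) : ℝ) + 1) - Real.log (p + 1 : ℕ))
      atTop (𝓝 0) :=
    (Real.tendsto_log_nat_add_one_sub_log).comp (tendsto_add_atTop_nat 1)
  rw [← tendsto_add_atTop_iff_nat 1]
  have h := ((hlog.sub hll).add hDre).sub_const (Real.eulerMascheroniConstant + Real.log x)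
  simp only [sub_zero, add_zero, sub_self] at h
  refine h.congr fun p => ?_
  simp only [hEp, Function.comp_apply]
  push_cast
  ring

end DartGame

/-! ### Assembling the theorem -/

namespace DartGame

variable {Ω : Type*} [MeasurableSpace Ω] {μ : Measure Ω} {X : ℕ → Ω → ℝ}

/-- An atom of mass `m` would make the first two throws tie with probability at least `m ^ 2`. -/
theorem nullSingletonClass_of_no_ties (hmeas : ∀ i, Measurable (X i)) (hindep : iIndepFun X μ)
    (hident : ∀ i, IdentDistrib (X i) (X 0) μ μ) (hties : μ {ω | X 0 ω = X 1 ω} = 0) :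
    NullSingletonClass (μ.map (X 0)) := by
  refine ⟨fun t => ?_⟩
  have ht := measurableSet_singleton t
  have h := (hindep.indepFun zero_ne_one).measure_inter_preimage_eq_mul {t} {t} ht ht
  have h1 : μ (X 1 ⁻¹' {t}) = μ (X 0 ⁻¹' {t}) := (hident 1).measure_mem_eq ht
  have h2 : μ (X 0 ⁻¹' {t} ∩ X 1 ⁻¹' {t}) = 0 :=
    measure_mono_null (fun ω hω => hω.1.trans hω.2.symm) hties
  rw [h2, h1] at h
  rw [Measure.map_apply (hmeas 0) ht]
  exact mul_self_eq_zero.1 h.symm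

theorem integral_pow_eliminations [IsProbabilityMeasure μ]
    (hmeas : ∀ i, Measurable (X i)) (hindep : iIndepFun X μ)
    (hident : ∀ i, IdentDistrib (X i) (X 0) μ μ) (hties : μ {ω | X 0 ω = X 1 ω} = 0) (d : EReal)
    {u : ℂ} (hu : u ≠ 0) (n : ℕ) :
    ∫ ω, u ^ eliminations n (fun i => X i ω) d ∂μ =
      u ^ n * recordGenFun u⁻¹ (1 - μ.real {ω | (X 0 ω : EReal) < d}) n := by
  have := nullSingletonClass_of_no_ties hmeas hindep hident hties
  have : IsProbabilityMeasure (μ.map (X 0)) :=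
    Measure.isProbabilityMeasure_map (hmeas 0).aemeasurable
  have h := integral_pow_records μ (μ.map (X 0)) u⁻¹ n X hmeas hindep
    (fun i => (hident i).map_eq) d
  rw [map_measureReal_apply (hmeas 0) (measurableSet_coe_lt d)] at h
  refine Eq.trans ?_ (congrArg (u ^ n * ·) h)
  rw [← integral_const_mul]
  refine integral_congr_ae (Eventually.of_forall fun ω => ?_)
  have hle := eliminations_le n (fun i => X i ω) d
  simp only
  rw [inv_pow, ← div_eq_mul_inv, eq_div_iff (pow_ne_zero _ hu), ← pow_add,
    Nat.add_sub_cancel' hle]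

/-- The survival probabilities have a summable generating function. -/
theorem hasSum_survivalProb [IsProbabilityMeasure μ]
    (hmeas : ∀ i, Measurable (X i)) (hindep : iIndepFun X μ)
    (hident : ∀ i, IdentDistrib (X i) (X 0) μ μ) (hties : μ {ω | X 0 ω = X 1 ω} = 0) (d : EReal)
    {q : ℂ} (hq : q = 1 - μ.real {ω | (X 0 ω : EReal) < d}) (hq1 : ‖q‖ ≤ 1)
    {u z : ℂ} (hu0 : u ≠ 0) (hu : ‖u‖ < 1) (huz : ‖u * z‖ < 1) :
    HasSum (fun i : ℕ × ℕ => (survivalProb μ X d i.1 i.2 : ℂ) * u ^ (i.2 + 1) * z ^ i.1)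
      (survivalGenFun q u z) :=
  hasSum_survival (fun n => measurable_eliminations_comp hmeas d n) hq1
    (fun _ hu n => hq ▸ integral_pow_eliminations hmeas hindep hident hties d hu n) hu0 hu huz

theorem summable_survivalProb {d : EReal}
    (h : ∀ u : ℂ, u ≠ 0 → ‖u‖ < 1 → Summable fun i : ℕ × ℕ =>
      (survivalProb μ X d i.1 i.2 : ℂ) * u ^ (i.2 + 1)) (p : ℕ) :
    Summable fun n => survivalProb μ X d n p := by
  have h2 : ((2 : ℂ)⁻¹) ≠ 0 := by norm_num
  -- Any nonzero `u` in the disc would do: for fixed `p` its power is a constant factor.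
  have h' := (h 2⁻¹ h2 (by norm_num)).comp_injective (Prod.mk_left_injective p)
  have := (summable_mul_right_iff (pow_ne_zero (p + 1) h2)).1 h'
  exact Complex.summable_ofReal.1 this

theorem toReal_expectedThrows [IsProbabilityMeasure μ]
    (hmeas : ∀ i, Measurable (X i)) {d : EReal} {p : ℕ}
    (h : Summable fun n => survivalProb μ X d n p) :
    expectedThrows μ X d (p + 1) ≠ ⊤ ∧
      HasSum (fun n => survivalProb μ X d n p) (expectedThrows μ X d (p + 1)).toReal := by
  have h0 : ∀ n, 0 ≤ survivalProb μ X d n p := fun n => measureReal_nonneg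
  rw [expectedThrows_succ hmeas, ← ENNReal.ofReal_tsum_of_nonneg h0 h,
    ENNReal.toReal_ofReal (tsum_nonneg h0)]
  exact ⟨ENNReal.ofReal_ne_top, h.hasSum⟩

end DartGame

theorem mainTheorem4 {Ω : Type*} [MeasurableSpace Ω] (μ : Measure Ω) [IsProbabilityMeasure μ]
    -- the distances to the center of the further throws
    (X : ℕ → Ω → ℝ) (hmeas : ∀ i, Measurable (X i)) (hindep : iIndepFun X μ)
    (hident : ∀ i, IdentDistrib (X i) (X 0) μ μ)
    (hties : ∀ i j, i ≠ j → μ {ω | X i ω = X j ω} = 0)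
    -- the best throw so far, and the probability to beat it
    (d : EReal) (x : ℝ) (hx : x = μ.real {ω | (X 0 ω : EReal) < d}) :
    (∀ p : ℕ, 1 ≤ p → DartGame.expectedThrows μ X d p ≠ ⊤) ∧
    (∀ u : ℂ, u ≠ 0 → ‖u‖ < 1 →
      HasSum (fun p : ℕ => ((DartGame.expectedThrows μ X d (p + 1)).toReal : ℂ) * u ^ (p + 1))
        (u ^ 2 / (1 - u) ^ 2 * ((1 - u) / (1 - (1 - (x : ℂ)) * u)) ^ (1 - 1 / u)) ∧
      (∀ᶠ z in 𝓝 (1 : ℂ), Summable (DartGame.endProbTerm μ X d u z)) ∧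
      HasDerivAt (fun z : ℂ => DartGame.endProbGenFun μ X d u z)
        (u ^ 2 / (1 - u) ^ 2 * ((1 - u) / (1 - (1 - (x : ℂ)) * u)) ^ (1 - 1 / u)) 1) ∧
    (0 < x → Tendsto (fun p : ℕ => (DartGame.expectedThrows μ X d p).toReal -
      (p + Real.log p + Real.eulerMascheroniConstant - 1 + Real.log x)) atTop (𝓝 0)) := by
  have hx0 : 0 ≤ x := hx ▸ measureReal_nonneg
  have hx1 : x ≤ 1 := hx ▸ measureReal_le_one
  have hq : ‖1 - (x : ℂ)‖ ≤ 1 := by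
    have := DartGame.norm_ofReal_le_one (sub_nonneg.2 hx1) (sub_le_self 1 hx0)
    rwa [Complex.ofReal_sub, Complex.ofReal_one] at this
  have hsurv : ∀ u z : ℂ, u ≠ 0 → ‖u‖ < 1 → ‖u * z‖ < 1 → HasSum (fun i : ℕ × ℕ =>
      (DartGame.survivalProb μ X d i.1 i.2 : ℂ) * u ^ (i.2 + 1) * z ^ i.1)
      (DartGame.survivalGenFun (1 - (x : ℂ)) u z) := fun u z hu0 hu huz =>
    DartGame.hasSum_survivalProb hmeas hindep hident (hties 0 1 zero_ne_one) d (by rw [hx]) hq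
      hu0 hu huz
  have hsurv1 : ∀ u : ℂ, u ≠ 0 → ‖u‖ < 1 → HasSum (fun i : ℕ × ℕ =>
      (DartGame.survivalProb μ X d i.1 i.2 : ℂ) * u ^ (i.2 + 1))
      (DartGame.expectedGenFun (1 - (x : ℂ)) u) := fun u hu0 hu => by
    have h := hsurv u 1 hu0 hu (by rwa [mul_one])
    rw [DartGame.survivalGenFun_one hq hu] at h
    simpa using h
  have hexp := fun p => DartGame.toReal_expectedThrows hmeas
    (DartGame.summable_survivalProb (fun u hu0 hu => (hsurv1 u hu0 hu).summable) p)
  have hE : ∀ u : ℂ, u ≠ 0 → ‖u‖ < 1 → HasSum (fun p : ℕ =>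
      ((DartGame.expectedThrows μ X d (p + 1)).toReal : ℂ) * u ^ (p + 1))
      (DartGame.expectedGenFun (1 - (x : ℂ)) u) := fun u hu0 hu => by
    have h := ((Equiv.prodComm ℕ ℕ).hasSum_iff (f := fun i : ℕ × ℕ =>
      (DartGame.survivalProb μ X d i.1 i.2 : ℂ) * u ^ (i.2 + 1))).2 (hsurv1 u hu0 hu)
    exact h.prod_fiberwise fun p =>
      (Complex.hasSum_ofReal.2 (hexp p).2).mul_right (u ^ (p + 1))
  refine ⟨fun p hp => ?_, fun u hu0 hu => ⟨hE u hu0 hu, ?_⟩, fun hxpos => ?_⟩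
  · obtain ⟨k, rfl⟩ := Nat.exists_eq_add_of_le' hp
    exact (hexp k).1
  · have hnhds : ∀ᶠ z in 𝓝 (1 : ℂ), ‖u * z‖ < 1 := by
      have hc : Continuous fun z : ℂ => ‖u * z‖ := by fun_prop
      exact hc.continuousAt.eventually_lt continuousAt_const (by simpa using hu)
    have hterm : ∀ᶠ z in 𝓝 (1 : ℂ), HasSum (DartGame.endProbTerm μ X d u z)
        (u / (1 - u) + (z - 1) * DartGame.survivalGenFun (1 - (x : ℂ)) u z) := by
      filter_upwards [hnhds] with z hz
      exact DartGame.hasSum_endProbTerm hmeas d hu (hsurv u z hu0 hu hz)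
    refine ⟨hterm.mono fun z hz => hz.summable, ?_⟩
    -- The factor `z - 1` vanishes at `1`, so the derivative is `S(1)` and that of `S` drops out.
    have hd := (((hasDerivAt_id (1 : ℂ)).sub_const 1).mul
      (DartGame.differentiableAt_survivalGenFun hq hu).hasDerivAt).const_add (u / (1 - u))
    simp only [id, sub_self, one_mul, zero_mul, add_zero,
      DartGame.survivalGenFun_one hq hu] at hd
    exact hd.congr_of_eventuallyEq (hterm.mono fun z hz => hz.tsum_eq)
  · rw [← tendsto_add_atTop_iff_nat 1]
    exact DartGame.tendsto_expected hxpos hx1 hE
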